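/- Let $d\ge 1$ be an integer and $u\in\mathbb{C}\setminus\{0,1\}$. The Yokonuma–Hecke algebra ${\rm Y}_{d,n}={\rm Y}_{d,n}(u)$ is the $\mathbb{C}$-algebra generated by $t_1,\dots,t_n,g_1,\dots,g_{n-1}$ with the relations $g_ig_j=g_jg_i$ for $|i-j|>1$, $g_ig_{i+1}g_i=g_{i+1}g_ig_{i+1}$, $t_jt_k=t_kt_j$, $t_j^d=1$, $g_it_i=t_{i+1}g_i$, $g_it_{i+1}=t_ig_i$, $g_it_j=t_jg_i$ for $j\ne i,i+1$, and $g_i^2=1+(u-1)e_i+(u-1)e_ig_i$, where $e_i=\frac1d\sum_{m=0}^{d-1}t_i^mt_{i+1}^{-m}$. The algebra ${\rm YTL}_{d,n}$ is the quotient of ${\rm Y}_{d,n}$ by the two-sided ideal generated by the elements $L_i=g_ig_{i+1}g_i+g_ig_{i+1}+g_{i+1}g_i+g_i+g_{i+1}+1$, $1\le i\le n-2$. Let ${\rm Y}_{d,\infty}$ and ${\rm YTL}_{d,\infty}$ be the inductive limits over $n$. For $z,x_1,\dots,x_{d-1}\in\mathbb{C}$ let ${\rm tr}:{\rm Y}_{d,\infty}\to\mathbb{C}$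 be the Juyumaya trace with these parameters, that is, the linear functional with ${\rm tr}(ab)={\rm tr}(ba)$, ${\rm tr}(1)=1$, ${\rm tr}(ag_nb)=z\,{\rm tr}(ab)$ for $n\ge 1$ and $a,b\in{\rm Y}_{d,n}$, and ${\rm tr}(at_{n+1}^s)=x_s{\rm tr}(a)$ for $n\ge 0$, $a\in{\rm Y}_{d,n}$, $1\le s\le d-1$. Put $x_0=1$, read indices modulo $d$, and let ${\rm E}_d=\frac1d\sum_{m=0}^{d-1}x_mx_{-m}$. (1) For all $z,x_1,\dots,x_{d-1}$ one has ${\rm tr}(e_i)={\rm E}_d$ for all $i\ge1$, and for every $i\ge 1$ the trace respects the linear relation on $g_ig_{i+1}g_i$, i.e. ${\rm tr}(L_i)=0$, if and only if $$(u+1)z^2+\big((u-1){\rm E}_d+3\big)z+1=0;$$ for $u\ne-1$ this means that $z$ is one of $$z_{1,2}=\frac{-u{\rm E}_d\pm\sqrt{(u{\rm E}_d-{\rm E}_d+3)^2-4(u+1)}+{\rm E}_d-3}{2(u+1)}.$$ If ${\rm tr}$ factors through the quotient map ${\rm Y}_{d,\infty}\to{\rm YTL}_{d,\infty}$, then $z$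 satisfies this equation. (2) Let $d\ge2$. For generic $x_1,\dots,x_{d-1}$ the Juyumaya trace does not pass through to the quotient, whatever $z$ is. More precisely, there is a nonzero polynomial $P\in\mathbb{C}[X_1,\dots,X_{d-1}]$, depending only on $d$ and $u$, such that for all $x_1,\dots,x_{d-1}\in\mathbb{C}$ with $P(x_1,\dots,x_{d-1})\neq0$ and all $z\in\mathbb{C}$: ${\rm tr}$ does not factor through ${\rm YTL}_{d,\infty}$; for every $n\ge3$ the restriction of ${\rm tr}$ to ${\rm Y}_{d,n}$ does not factor through ${\rm YTL}_{d,n}$; and if $z$ satisfies the equation in (1), then for all integers $k_1,k_2,k\ge0$ that are not all divisible by $d$, with $w=t_1^{k_1}t_2^{k_2}t_3^{k}$, $${\rm tr}(wg_1g_2g_1)\neq{\rm tr}\big(w(-g_1g_2-g_2g_1-g_1-g_2-1)\big).$$ -/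

import Mathlib

noncomputable section

namespace Yokonuma

/-- Generators of the Yokonuma-Hecke algebra on `n` strands:
`t_1, …, t_n` and `g_1, …, g_{n-1}`. -/
inductive Gen (n : ℕ) : Type
  | t (j : ℕ) (h : 1 ≤ j ∧ j ≤ n) : Gen n
  | g (i : ℕ) (h : 1 ≤ i ∧ i < n) : Gen n

/-- `(1/d) ∑_{m=0}^{d-1} a^m b^{-m}`, for elements `a`, `b` with `b^d = 1`
(so that `b^{-m} = b^{d-m}`). -/
def avg {A : Type} [Ring A] [Algebra ℂ A] (d : ℕ) (a b : A) : A :=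
  (1 / (d : ℂ)) • ∑ m ∈ Finset.range d, a ^ m * b ^ (d - m)

/-- The expression `a b a + a b + b a + a + b + 1`. -/
def lin {A : Type} [Ring A] (a b : A) : A :=
  a * b * a + a * b + b * a + a + b + 1

theorem map_avg {A B : Type} [Ring A] [Algebra ℂ A] [Ring B] [Algebra ℂ B] (f : A →ₐ[ℂ] B)
    (d : ℕ) (a b : A) : f (avg d a b) = avg d (f a) (f b) := by
  simp [avg, map_sum]

theorem map_lin {A B : Type} [Ring A] [Algebra ℂ A] [Ring B] [Algebra ℂ B] (f : A →ₐ[ℂ] B)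
    (a b : A) : f (lin a b) = lin (f a) (f b) := by
  simp [lin]

/-- The free generator `t_j`. -/
def tF {n : ℕ} (j : ℕ) (h : 1 ≤ j ∧ j ≤ n) : FreeAlgebra ℂ (Gen n) :=
  FreeAlgebra.ι ℂ (Gen.t j h)

/-- The free generator `g_i`. -/
def gF {n : ℕ} (i : ℕ) (h : 1 ≤ i ∧ i < n) : FreeAlgebra ℂ (Gen n) :=
  FreeAlgebra.ι ℂ (Gen.g i h)

/-- The defining relations of the Yokonuma-Hecke algebra `Y_{d,n}(u)`. -/
inductive YRel (d : ℕ) (u : ℂ) (n : ℕ) :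
    FreeAlgebra ℂ (Gen n) → FreeAlgebra ℂ (Gen n) → Prop
  | far (i j : ℕ) (hi : 1 ≤ i ∧ i < n) (hj : 1 ≤ j ∧ j < n) (hij : i + 1 < j) :
      YRel d u n (gF i hi * gF j hj) (gF j hj * gF i hi)
  | braid (i : ℕ) (hi : 1 ≤ i ∧ i < n) (hi' : 1 ≤ i + 1 ∧ i + 1 < n) :
      YRel d u n (gF i hi * gF (i + 1) hi' * gF i hi)
        (gF (i + 1) hi' * gF i hi * gF (i + 1) hi')
  | comm (j k : ℕ) (hj : 1 ≤ j ∧ j ≤ n) (hk : 1 ≤ k ∧ k ≤ n) :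
      YRel d u n (tF j hj * tF k hk) (tF k hk * tF j hj)
  | modular (j : ℕ) (hj : 1 ≤ j ∧ j ≤ n) :
      YRel d u n (tF j hj ^ d) 1
  | mixed_left (i : ℕ) (hi : 1 ≤ i ∧ i < n) (h : 1 ≤ i ∧ i ≤ n) (h' : 1 ≤ i + 1 ∧ i + 1 ≤ n) :
      YRel d u n (gF i hi * tF i h) (tF (i + 1) h' * gF i hi)
  | mixed_right (i : ℕ) (hi : 1 ≤ i ∧ i < n) (h : 1 ≤ i ∧ i ≤ n) (h' : 1 ≤ i + 1 ∧ i + 1 ≤ n) :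
      YRel d u n (gF i hi * tF (i + 1) h') (tF i h * gF i hi)
  | mixed_far (i j : ℕ) (hi : 1 ≤ i ∧ i < n) (hj : 1 ≤ j ∧ j ≤ n) (h : j ≠ i) (h' : j ≠ i + 1) :
      YRel d u n (gF i hi * tF j hj) (tF j hj * gF i hi)
  | quadratic (i : ℕ) (hi : 1 ≤ i ∧ i < n) (h : 1 ≤ i ∧ i ≤ n) (h' : 1 ≤ i + 1 ∧ i + 1 ≤ n) :
      YRel d u n (gF i hi ^ 2)
        (1 + (u - 1) • avg d (tF i h) (tF (i + 1) h')
          + (u - 1) • (avg d (tF i h) (tF (i + 1) h') * gF i hi))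

/-- The Yokonuma-Hecke algebra `Y_{d,n}(u)`. -/
def Y (d : ℕ) (u : ℂ) (n : ℕ) : Type := RingQuot (YRel d u n)

instance (d : ℕ) (u : ℂ) (n : ℕ) : Ring (Y d u n) :=
  inferInstanceAs (Ring (RingQuot (YRel d u n)))

instance (d : ℕ) (u : ℂ) (n : ℕ) : Algebra ℂ (Y d u n) :=
  inferInstanceAs (Algebra ℂ (RingQuot (YRel d u n)))

/-- The quotient map from the free algebra onto `Y_{d,n}(u)`. -/
def Y.mk (d : ℕ) (u : ℂ) (n : ℕ) : FreeAlgebra ℂ (Gen n) →ₐ[ℂ] Y d u n :=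
  RingQuot.mkAlgHom ℂ (YRel d u n)

theorem Y.mk_rel {d : ℕ} {u : ℂ} {n : ℕ} {a b : FreeAlgebra ℂ (Gen n)} (h : YRel d u n a b) :
    Y.mk d u n a = Y.mk d u n b :=
  RingQuot.mkAlgHom_rel ℂ h

/-- The element `t_j` of `Y_{d,n}(u)`, `1 ≤ j ≤ n`. -/
def Y.t (d : ℕ) (u : ℂ) (n j : ℕ) (h : 1 ≤ j ∧ j ≤ n := by omega) : Y d u n :=
  Y.mk d u n (tF j h)

/-- The element `g_i` of `Y_{d,n}(u)`, `1 ≤ i ≤ n - 1`. -/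
def Y.g (d : ℕ) (u : ℂ) (n i : ℕ) (h : 1 ≤ i ∧ i < n := by omega) : Y d u n :=
  Y.mk d u n (gF i h)

/-- The images in `Y_{d,m}(u)` of the generators on `n ≤ m` strands. -/
def Y.genMap (d : ℕ) (u : ℂ) {n m : ℕ} (hnm : n ≤ m) : Gen n → Y d u m
  | Gen.t j h => Y.t d u m j ⟨h.1, h.2.trans hnm⟩
  | Gen.g i h => Y.g d u m i ⟨h.1, h.2.trans_le hnm⟩

theorem Y.genMap_rel (d : ℕ) (u : ℂ) {n m : ℕ} (hnm : n ≤ m) ⦃a b : FreeAlgebra ℂ (Gen n)⦄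
    (h : YRel d u n a b) :
    FreeAlgebra.lift ℂ (Y.genMap d u hnm) a = FreeAlgebra.lift ℂ (Y.genMap d u hnm) b := by
  have ht : ∀ (j : ℕ) (h : 1 ≤ j ∧ j ≤ n), FreeAlgebra.lift ℂ (Y.genMap d u hnm) (tF j h) =
      Y.mk d u m (tF j ⟨h.1, h.2.trans hnm⟩) := fun j h => by
    simp [tF, Y.genMap, Y.t]
  have hg : ∀ (i : ℕ) (h : 1 ≤ i ∧ i < n), FreeAlgebra.lift ℂ (Y.genMap d u hnm) (gF i h) =
      Y.mk d u m (gF i ⟨h.1, h.2.trans_le hnm⟩) := fun i h => by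
    simp [gF, Y.genMap, Y.g]
  cases h with
  | far i j hi hj hij =>
    simp only [map_mul, hg]
    simpa only [map_mul] using Y.mk_rel (YRel.far (d := d) (u := u) i j _ _ hij)
  | braid i hi hi' =>
    simp only [map_mul, hg]
    simpa only [map_mul] using Y.mk_rel (YRel.braid (d := d) (u := u) i _ _)
  | comm j k hj hk =>
    simp only [map_mul, ht]
    simpa only [map_mul] using Y.mk_rel (YRel.comm (d := d) (u := u) j k _ _)
  | modular j hj =>
    simp only [map_pow, ht, map_one]
    simpa only [map_pow, map_one] using Y.mk_rel (YRel.modular (d := d) (u := u) j _)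
  | mixed_left i hi h h' =>
    simp only [map_mul, hg, ht]
    simpa only [map_mul] using Y.mk_rel (YRel.mixed_left (d := d) (u := u) i _ _ _)
  | mixed_right i hi h h' =>
    simp only [map_mul, hg, ht]
    simpa only [map_mul] using Y.mk_rel (YRel.mixed_right (d := d) (u := u) i _ _ _)
  | mixed_far i j hi hj h h' =>
    simp only [map_mul, hg, ht]
    simpa only [map_mul] using Y.mk_rel (YRel.mixed_far (d := d) (u := u) i j _ _ h h')
  | quadratic i hi h h' =>
    simp only [map_mul, map_pow, map_add, map_one, map_smul, map_avg, hg, ht]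
    simpa only [map_mul, map_pow, map_add, map_one, map_smul, map_avg] using
      Y.mk_rel (YRel.quadratic (d := d) (u := u) i _ _ _)

/-- The natural map `Y_{d,n}(u) → Y_{d,m}(u)` for `n ≤ m`, which sends `t_j` to `t_j` and `g_i` to
`g_i`. -/
def Y.incl (d : ℕ) (u : ℂ) (n m : ℕ) (hnm : n ≤ m) : Y d u n →ₐ[ℂ] Y d u m :=
  RingQuot.liftAlgHom ℂ ⟨FreeAlgebra.lift ℂ (Y.genMap d u hnm), Y.genMap_rel d u hnm⟩

theorem Y.incl_mk (d : ℕ) (u : ℂ) (n m : ℕ) (hnm : n ≤ m) (a : FreeAlgebra ℂ (Gen n)) :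
    Y.incl d u n m hnm (Y.mk d u n a) = FreeAlgebra.lift ℂ (Y.genMap d u hnm) a :=
  RingQuot.liftAlgHom_mkAlgHom_apply ..

theorem Y.incl_t (d : ℕ) (u : ℂ) (n m : ℕ) (hnm : n ≤ m) (j : ℕ) (h : 1 ≤ j ∧ j ≤ n) :
    Y.incl d u n m hnm (Y.t d u n j h) = Y.t d u m j ⟨h.1, h.2.trans hnm⟩ := by
  rw [Y.t, Y.incl_mk]; simp [tF, Y.genMap]

theorem Y.incl_g (d : ℕ) (u : ℂ) (n m : ℕ) (hnm : n ≤ m) (i : ℕ) (h : 1 ≤ i ∧ i < n) :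
    Y.incl d u n m hnm (Y.g d u n i h) = Y.g d u m i ⟨h.1, h.2.trans_le hnm⟩ := by
  rw [Y.g, Y.incl_mk]; simp [gF, Y.genMap]

/-- Algebra maps out of `Y_{d,n}(u)` that agree on the generators are equal. -/
theorem Y.hom_ext {d : ℕ} {u : ℂ} {n : ℕ} {A : Type} [Ring A] [Algebra ℂ A]
    {f f' : Y d u n →ₐ[ℂ] A} (ht : ∀ j h, f (Y.t d u n j h) = f' (Y.t d u n j h))
    (hg : ∀ i h, f (Y.g d u n i h) = f' (Y.g d u n i h)) : f = f' := by
  refine RingQuot.ringQuot_ext' ℂ f f' (FreeAlgebra.hom_ext (funext fun x => ?_))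
  cases x with
  | t j h => exact ht j h
  | g i h => exact hg i h

instance (d : ℕ) (u : ℂ) : DirectedSystem (Y d u) (fun n m h => Y.incl d u n m h) where
  map_self n a := by
    have : Y.incl d u n n le_rfl = AlgHom.id ℂ _ :=
      Y.hom_ext (fun j h => by simp [Y.incl_t]) (fun i h => by simp [Y.incl_g])
    exact DFunLike.congr_fun this a
  map_map k j i hij hjk a := by
    have : (Y.incl d u j k hjk).comp (Y.incl d u i j hij) = Y.incl d u i k (hij.trans hjk) :=
      Y.hom_ext (fun j h => by simp [Y.incl_t]) (fun i h => by simp [Y.incl_g])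
    exact DFunLike.congr_fun this a

/-- `Y_{d,∞}(u)`, the inductive limit of the algebras `Y_{d,n}(u)`. -/
def YInf (d : ℕ) (u : ℂ) : Type := DirectLimit (Y d u) (Y.incl d u)

instance (d : ℕ) (u : ℂ) : Ring (YInf d u) :=
  inferInstanceAs (Ring (DirectLimit (Y d u) (Y.incl d u)))

instance (d : ℕ) (u : ℂ) : Algebra ℂ (YInf d u) :=
  inferInstanceAs (Algebra ℂ (DirectLimit (Y d u) (Y.incl d u)))

/-- The canonical map `Y_{d,n}(u) → Y_{d,∞}(u)`. -/
def Y.toInf (d : ℕ) (u : ℂ) (n : ℕ) : Y d u n →ₐ[ℂ] YInf d u where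
  __ := DirectLimit.Ring.of (Y d u) (Y.incl d u) n
  commutes' r := (DirectLimit.algebraMap_def n r).symm

/-- The element `t_j` of `Y_{d,∞}(u)`. -/
def YInf.t (d : ℕ) (u : ℂ) (j : ℕ) (h : 1 ≤ j := by omega) : YInf d u :=
  Y.toInf d u j (Y.t d u j j)

/-- The element `g_i` of `Y_{d,∞}(u)`. -/
def YInf.g (d : ℕ) (u : ℂ) (i : ℕ) (h : 1 ≤ i := by omega) : YInf d u :=
  Y.toInf d u (i + 1) (Y.g d u (i + 1) i)

/-- The element `e_i` of `Y_{d,∞}(u)`. -/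
def YInf.e (d : ℕ) (u : ℂ) (i : ℕ) (h : 1 ≤ i := by omega) : YInf d u :=
  avg d (YInf.t d u i) (YInf.t d u (i + 1))

/-- The elements of `Y_{d,n}(u)` that are set to zero in the Yokonuma-Temperley-Lieb algebra. -/
inductive YTLRel (d : ℕ) (u : ℂ) (n : ℕ) : Y d u n → Y d u n → Prop
  | linear (i : ℕ) (hi : 1 ≤ i ∧ i < n) (hi' : 1 ≤ i + 1 ∧ i + 1 < n) :
      YTLRel d u n (lin (Y.g d u n i hi) (Y.g d u n (i + 1) hi')) 0

/-- The Yokonuma-Temperley-Lieb algebra `YTL_{d,n}(u)`. -/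
def YTL (d : ℕ) (u : ℂ) (n : ℕ) : Type := RingQuot (YTLRel d u n)

instance (d : ℕ) (u : ℂ) (n : ℕ) : Ring (YTL d u n) :=
  inferInstanceAs (Ring (RingQuot (YTLRel d u n)))

instance (d : ℕ) (u : ℂ) (n : ℕ) : Algebra ℂ (YTL d u n) :=
  inferInstanceAs (Algebra ℂ (RingQuot (YTLRel d u n)))

/-- The quotient map `Y_{d,n}(u) → YTL_{d,n}(u)`. -/
def YTL.mk (d : ℕ) (u : ℂ) (n : ℕ) : Y d u n →ₐ[ℂ] YTL d u n :=
  RingQuot.mkAlgHom ℂ (YTLRel d u n)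

theorem YTL.incl_rel (d : ℕ) (u : ℂ) (n m : ℕ) (hnm : n ≤ m) ⦃a b : Y d u n⦄
    (h : YTLRel d u n a b) :
    (YTL.mk d u m).comp (Y.incl d u n m hnm) a = (YTL.mk d u m).comp (Y.incl d u n m hnm) b := by
  cases h with
  | linear i hi hi' =>
    simp only [AlgHom.comp_apply, map_lin (Y.incl d u n m hnm), Y.incl_g, map_zero]
    have := RingQuot.mkAlgHom_rel ℂ (YTLRel.linear (d := d) (u := u) (n := m) i
      ⟨hi.1, hi.2.trans_le hnm⟩ ⟨hi'.1, hi'.2.trans_le hnm⟩)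
    exact this.trans (map_zero _)

/-- The natural map `YTL_{d,n}(u) → YTL_{d,m}(u)` for `n ≤ m`, induced by `Y_{d,n} → Y_{d,m}`. -/
def YTL.incl (d : ℕ) (u : ℂ) (n m : ℕ) (hnm : n ≤ m) : YTL d u n →ₐ[ℂ] YTL d u m :=
  RingQuot.liftAlgHom ℂ ⟨(YTL.mk d u m).comp (Y.incl d u n m hnm), YTL.incl_rel d u n m hnm⟩

theorem YTL.incl_mk (d : ℕ) (u : ℂ) (n m : ℕ) (hnm : n ≤ m) (a : Y d u n) :
    YTL.incl d u n m hnm (YTL.mk d u n a) = YTL.mk d u m (Y.incl d u n m hnm a) :=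
  RingQuot.liftAlgHom_mkAlgHom_apply ..

theorem YTL.mk_surjective (d : ℕ) (u : ℂ) (n : ℕ) : Function.Surjective (YTL.mk d u n) :=
  RingQuot.mkAlgHom_surjective ℂ (YTLRel d u n)

instance (d : ℕ) (u : ℂ) : DirectedSystem (YTL d u) (fun n m h => YTL.incl d u n m h) where
  map_self n a := by
    obtain ⟨a, rfl⟩ := YTL.mk_surjective d u n a
    rw [YTL.incl_mk, DirectedSystem.map_self (f := fun n m h => Y.incl d u n m h)]
  map_map k j i hij hjk a := by
    obtain ⟨a, rfl⟩ := YTL.mk_surjective d u i a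
    rw [YTL.incl_mk, YTL.incl_mk, YTL.incl_mk,
      DirectedSystem.map_map (f := fun n m h => Y.incl d u n m h)]

/-- `YTL_{d,∞}(u)`, the inductive limit of the algebras `YTL_{d,n}(u)`. -/
def YTLInf (d : ℕ) (u : ℂ) : Type := DirectLimit (YTL d u) (YTL.incl d u)

instance (d : ℕ) (u : ℂ) : Ring (YTLInf d u) :=
  inferInstanceAs (Ring (DirectLimit (YTL d u) (YTL.incl d u)))

instance (d : ℕ) (u : ℂ) : Algebra ℂ (YTLInf d u) :=
  inferInstanceAs (Algebra ℂ (DirectLimit (YTL d u) (YTL.incl d u)))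

/-- The canonical map `YTL_{d,n}(u) → YTL_{d,∞}(u)`. -/
def YTL.toInf (d : ℕ) (u : ℂ) (n : ℕ) : YTL d u n →ₐ[ℂ] YTLInf d u where
  __ := DirectLimit.Ring.of (YTL d u) (YTL.incl d u) n
  commutes' r := (DirectLimit.algebraMap_def n r).symm

theorem YTL.toInf_incl (d : ℕ) (u : ℂ) (n m : ℕ) (hnm : n ≤ m) (a : YTL d u n) :
    YTL.toInf d u m (YTL.incl d u n m hnm a) = YTL.toInf d u n a :=
  DirectLimit.Ring.of_f ..

/-- The map `Y_{d,∞}(u) → YTL_{d,∞}(u)` induced by the quotient maps `Y_{d,n} → YTL_{d,n}`. -/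
def YTLInf.mk (d : ℕ) (u : ℂ) : YInf d u →+* YTLInf d u :=
  DirectLimit.Ring.lift (Y d u) (Y.incl d u) (YTLInf d u)
    (fun n => ((YTL.toInf d u n).comp (YTL.mk d u n) : Y d u n →+* YTLInf d u))
    (fun n m h a => by
      show YTL.toInf d u m (YTL.mk d u m (Y.incl d u n m h a)) =
        YTL.toInf d u n (YTL.mk d u n a)
      rw [← YTL.incl_mk, YTL.toInf_incl])

theorem YTLInf.mk_toInf (d : ℕ) (u : ℂ) (n : ℕ) (a : Y d u n) :
    YTLInf.mk d u (Y.toInf d u n a) = YTL.toInf d u n (YTL.mk d u n a) :=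
  rfl

/-- The Juyumaya trace on `Y_{d,∞}(u)` with parameters `z` and `x_1, …, x_{d-1}`
(here `x s` stands for `x_{s+1}`, `0 ≤ s < d - 1`): the linear functional determined by the
following four rules. -/
structure IsJuyumayaTrace (d : ℕ) (u z : ℂ) (x : Fin (d - 1) → ℂ)
    (tr : YInf d u →ₗ[ℂ] ℂ) : Prop where
  trace_mul_comm : ∀ a b : YInf d u, tr (a * b) = tr (b * a)
  trace_one : tr 1 = 1
  markov : ∀ (n : ℕ) (hn : 1 ≤ n) (a b : Y d u n),
    tr (Y.toInf d u n a * YInf.g d u n hn * Y.toInf d u n b) = z * tr (Y.toInf d u n (a * b))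
  framing : ∀ (n : ℕ) (a : Y d u n) (s : Fin (d - 1)),
    tr (Y.toInf d u n a * YInf.t d u (n + 1) ^ ((s : ℕ) + 1)) = x s * tr (Y.toInf d u n a)

/-- The functional `tr` on `Y_{d,∞}(u)` passes through to the quotient `YTL_{d,∞}(u)`. -/
def FactorsThroughYTLInf (d : ℕ) (u : ℂ) (tr : YInf d u →ₗ[ℂ] ℂ) : Prop :=
  ∃ τ : YTLInf d u →ₗ[ℂ] ℂ, ∀ a : YInf d u, τ (YTLInf.mk d u a) = tr a

/-- The restriction of the functional `tr` to `Y_{d,n}(u)` passes through to the quotient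
`YTL_{d,n}(u)`. -/
def FactorsThroughYTL (d : ℕ) (u : ℂ) (n : ℕ) (tr : YInf d u →ₗ[ℂ] ℂ) : Prop :=
  ∃ τ : YTL d u n →ₗ[ℂ] ℂ, ∀ a : Y d u n, τ (YTL.mk d u n a) = tr (Y.toInf d u n a)

/-- The parameter `x_k` for an arbitrary exponent `k`, read modulo `d`, with `x_0 = 1`. -/
def xPar (d : ℕ) (x : Fin (d - 1) → ℂ) (k : ℕ) : ℂ :=
  if h : 1 ≤ k % d ∧ k % d < d then x ⟨k % d - 1, by omega⟩ else 1

/-- `E_d = (1/d) ∑_{m=0}^{d-1} x_m x_{-m}`, indices modulo `d`. -/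
def Ed (d : ℕ) (x : Fin (d - 1) → ℂ) : ℂ :=
  (1 / (d : ℂ)) * ∑ m ∈ Finset.range d, xPar d x m * xPar d x (d - m)

/-- The value `z_1` of the trace parameter (for `u ≠ -1`). -/
def z₁ (u E : ℂ) : ℂ :=
  (-(u * E) + Complex.sqrt ((u * E - E + 3) ^ 2 - 4 * (u + 1)) + E - 3) / (2 * (u + 1))

/-- The value `z_2` of the trace parameter (for `u ≠ -1`). -/
def z₂ (u E : ℂ) : ℂ :=
  (-(u * E) - Complex.sqrt ((u * E - E + 3) ^ 2 - 4 * (u + 1)) + E - 3) / (2 * (u + 1))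

end Yokonuma

end

/-!
A trace with parameters `z`, `x₁, …, x_{d-1}` evaluates on `w L_i`, for a framing monomial
`w = t_i^a t_{i+1}^b t_{i+2}^c`, to a quadratic polynomial in `z` with leading coefficient
`(u + 1) x_s`, where `s = a + b + c`; this is a computation with the Markov rule and the quadratic
relation, in which `e_i` identifies `t_i` with `t_{i+1}`. For `w = 1` the value is the quadratic
in (1). If `tr` factors through the quotient, then `z` is a common root of that quadratic and of
`tr (w L_i) - x_s tr (L_i)`, which is linear in `z`. Their resultant is a polynomial in
`x₁, …, x_{d-1}`. It is nonzero, because on the line `x₁ = ⋯ = x_{d-1} = X` the term with the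
factor `E_d`, which is quadratic in `X`, has larger degree than the others. The polynomial `P` is
the product of these resultants over the exponents `a, b, c < d` that are not all zero.
-/

namespace Yokonuma

section Avg

variable {A : Type} [Ring A] [Algebra ℂ A] {d : ℕ} {a b : A}

theorem right_mul_avg (hab : Commute a b) (ha : a ^ d = 1) (hb : b ^ d = 1) :
    b * avg d a b = a * avg d a b := by
  let F (m : ℕ) : A := a ^ m * b ^ (d + 1 - m)
  have left_sum : a * ∑ m ∈ Finset.range d, a ^ m * b ^ (d - m) =
      ∑ m ∈ Finset.range d, F (m + 1) := by
    rw [Finset.mul_sum]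
    refine Finset.sum_congr rfl fun m _ => ?_
    simp only [F, pow_succ', mul_assoc, Nat.add_sub_add_right]
  have right_sum : b * ∑ m ∈ Finset.range d, a ^ m * b ^ (d - m) = ∑ m ∈ Finset.range d, F m := by
    rw [Finset.mul_sum]
    refine Finset.sum_congr rfl fun m hm => ?_
    have comm : b * a ^ m = a ^ m * b := (hab.pow_left m).eq.symm
    have exponent : d + 1 - m = d - m + 1 := Nat.sub_add_comm (Finset.mem_range.1 hm).le
    rw [← mul_assoc, comm, mul_assoc, ← pow_succ', ← exponent]
  have endpoints : F d = F 0 := by simp [F, ha, hb, pow_succ]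
  have shift : ∑ m ∈ Finset.range d, F (m + 1) + F 0 = ∑ m ∈ Finset.range d, F m + F d := by
    rw [← Finset.sum_range_succ', Finset.sum_range_succ]
  rw [endpoints] at shift
  rw [avg, mul_smul_comm, mul_smul_comm, left_sum, right_sum, add_right_cancel shift]

theorem right_pow_mul_avg (hab : Commute a b) (ha : a ^ d = 1) (hb : b ^ d = 1) (k : ℕ) :
    b ^ k * avg d a b = a ^ k * avg d a b := by
  induction k with
  | zero => simp
  | succ k ih =>
    rw [pow_succ, mul_assoc, right_mul_avg hab ha hb, ← mul_assoc, ← (hab.pow_right k).eq,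
      mul_assoc, ih, ← mul_assoc, ← pow_succ']

end Avg

section Parameters

variable {R S : Type*} [CommRing R] [CommRing S] {d : ℕ}

/-- The sequence `xPar` with values in an arbitrary ring, so that its entries may also be the
indeterminates of a polynomial ring. -/
def paramSeq (d : ℕ) (y : Fin (d - 1) → R) (k : ℕ) : R :=
  if h : 1 ≤ k % d ∧ k % d < d then y ⟨k % d - 1, by omega⟩ else 1

theorem paramSeq_eq_xPar (x : Fin (d - 1) → ℂ) : paramSeq d x = xPar d x :=
  rfl

theorem map_paramSeq (φ : R →+* S) (y : Fin (d - 1) → R) (k : ℕ) :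
    φ (paramSeq d y k) = paramSeq d (fun s => φ (y s)) k := by
  unfold paramSeq
  split_ifs <;> simp

theorem paramSeq_periodic (y : Fin (d - 1) → R) : Function.Periodic (paramSeq d y) d := by
  intro k
  simp [paramSeq]

theorem paramSeq_zero (y : Fin (d - 1) → R) : paramSeq d y 0 = 1 := by
  simp [paramSeq]

theorem paramSeq_const [NeZero d] (r : R) (k : ℕ) :
    paramSeq d (fun _ => r) k = if d ∣ k then 1 else r := by
  have := Nat.mod_lt k (NeZero.pos d)
  by_cases hk : d ∣ k
  · simp [paramSeq, hk, Nat.mod_eq_zero_of_dvd hk]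
  · have : k % d ≠ 0 := fun h0 => hk (Nat.dvd_of_mod_eq_zero h0)
    rw [paramSeq, dif_pos (by omega), if_neg hk]

variable [Algebra ℂ R] [Algebra ℂ S]

/-- `E_d^{(k)} = (1/d) ∑_{m=0}^{d-1} x_{k+m} x_{-m}`, the value of the trace at `t_i^k e_i`,
for a sequence `f` of period `d` in place of `x`. -/
noncomputable def shiftedEd (d : ℕ) (f : ℕ → R) (k : ℕ) : R :=
  (1 / (d : ℂ)) • ∑ m ∈ Finset.range d, f (k + m) * f (d - m)

theorem shiftedEd_zero (x : Fin (d - 1) → ℂ) : shiftedEd d (xPar d x) 0 = Ed d x := by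
  simp [shiftedEd, Ed]

theorem map_shiftedEd (φ : R →ₐ[ℂ] S) (f : ℕ → R) (k : ℕ) :
    φ (shiftedEd d f k) = shiftedEd d (fun m => φ (f m)) k := by
  simp [shiftedEd, map_sum]

theorem shiftedEd_of_dvd {f : ℕ → R} (hf : Function.Periodic f d) {k : ℕ} (hk : d ∣ k) :
    shiftedEd d f k = shiftedEd d f 0 := by
  obtain ⟨j, rfl⟩ := hk
  have shift (m : ℕ) : f (d * j + m) = f (0 + m) := by
    rw [mul_comm, add_comm, zero_add, ← smul_eq_mul, hf.nsmul]
  simp only [shiftedEd, shift]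

end Parameters

namespace YInf

variable {d : ℕ} {u : ℂ}

theorem toInf_incl (n m : ℕ) (hnm : n ≤ m) (a : Y d u n) :
    Y.toInf d u m (Y.incl d u n m hnm a) = Y.toInf d u n a :=
  DirectLimit.Ring.of_f ..

theorem toInf_t (n j : ℕ) (h : 1 ≤ j ∧ j ≤ n) : Y.toInf d u n (Y.t d u n j h) = t d u j h.1 := by
  rw [t, ← toInf_incl j n h.2, Y.incl_t]

theorem toInf_g (n i : ℕ) (h : 1 ≤ i ∧ i < n) : Y.toInf d u n (Y.g d u n i h) = g d u i h.1 := by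
  rw [g, ← toInf_incl (i + 1) n h.2, Y.incl_g]

theorem t_pow_mem {n j : ℕ} (hj : 1 ≤ j) (hjn : j ≤ n) (k : ℕ) :
    t d u j ^ k ∈ (Y.toInf d u n).range :=
  pow_mem (AlgHom.mem_range _ |>.2 ⟨Y.t d u n j ⟨hj, hjn⟩, toInf_t n j _⟩) k

theorem g_mem {n i : ℕ} (hi : 1 ≤ i) (hin : i < n) : g d u i ∈ (Y.toInf d u n).range :=
  ⟨Y.g d u n i ⟨hi, hin⟩, toInf_g n i _⟩

/-- The map from the free algebra on the generators of `Y_{d,n}(u)` to `Y_{d,∞}(u)`, along which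
the defining relations are carried to the limit. -/
noncomputable def ofFree (d : ℕ) (u : ℂ) (n : ℕ) : FreeAlgebra ℂ (Gen n) →ₐ[ℂ] YInf d u :=
  (Y.toInf d u n).comp (Y.mk d u n)

theorem ofFree_rel {n : ℕ} {a b : FreeAlgebra ℂ (Gen n)} (h : YRel d u n a b) :
    ofFree d u n a = ofFree d u n b :=
  congrArg (Y.toInf d u n) (Y.mk_rel h)

theorem ofFree_t (n j : ℕ) (h : 1 ≤ j ∧ j ≤ n) : ofFree d u n (tF j h) = t d u j h.1 :=
  toInf_t n j h

theorem ofFree_g (n i : ℕ) (h : 1 ≤ i ∧ i < n) : ofFree d u n (gF i h) = g d u i h.1 :=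
  toInf_g n i h

theorem commute_t_t (j k : ℕ) (hj : 1 ≤ j) (hk : 1 ≤ k) : Commute (t d u j) (t d u k) := by
  have rel := ofFree_rel (YRel.comm (d := d) (u := u) (n := max j k) j k
    ⟨hj, le_max_left _ _⟩ ⟨hk, le_max_right _ _⟩)
  simp only [map_mul, ofFree_t] at rel
  exact rel

theorem t_pow_d (j : ℕ) (hj : 1 ≤ j) : t d u j ^ d = 1 := by
  have rel := ofFree_rel (YRel.modular (d := d) (u := u) (n := j) j ⟨hj, le_rfl⟩)
  simpa only [map_pow, map_one, ofFree_t] using rel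

theorem t_pow_mod (j : ℕ) (hj : 1 ≤ j) (k : ℕ) : t d u j ^ (k % d) = t d u j ^ k :=
  (pow_eq_pow_mod k (t_pow_d j hj)).symm

theorem semiconjBy_g_t (i : ℕ) (hi : 1 ≤ i) :
    SemiconjBy (g d u i) (t d u i) (t d u (i + 1)) := by
  have rel := ofFree_rel (YRel.mixed_left (d := d) (u := u) (n := i + 1) i
    ⟨hi, by omega⟩ ⟨hi, by omega⟩ ⟨by omega, by omega⟩)
  simp only [map_mul, ofFree_t, ofFree_g] at rel
  exact rel

theorem semiconjBy_g_t_succ (i : ℕ) (hi : 1 ≤ i) :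
    SemiconjBy (g d u i) (t d u (i + 1)) (t d u i) := by
  have rel := ofFree_rel (YRel.mixed_right (d := d) (u := u) (n := i + 1) i
    ⟨hi, by omega⟩ ⟨hi, by omega⟩ ⟨by omega, by omega⟩)
  simp only [map_mul, ofFree_t, ofFree_g] at rel
  exact rel

theorem commute_g_t (i j : ℕ) (hi : 1 ≤ i) (hj : 1 ≤ j) (h : j ≠ i) (h' : j ≠ i + 1) :
    Commute (g d u i) (t d u j) := by
  have rel := ofFree_rel (YRel.mixed_far (d := d) (u := u) (n := i + j) i j
    ⟨hi, by omega⟩ ⟨hj, by omega⟩ h h')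
  simp only [map_mul, ofFree_t, ofFree_g] at rel
  exact rel

theorem g_sq (i : ℕ) (hi : 1 ≤ i) :
    g d u i ^ 2 = 1 + (u - 1) • e d u i + (u - 1) • (e d u i * g d u i) := by
  have rel := ofFree_rel (YRel.quadratic (d := d) (u := u) (n := i + 1) i
    ⟨hi, by omega⟩ ⟨hi, by omega⟩ ⟨by omega, by omega⟩)
  simpa only [map_mul, map_pow, map_add, map_one, map_smul, map_avg, ofFree_t, ofFree_g, e]
    using rel

theorem t_succ_pow_mul_e (i : ℕ) (hi : 1 ≤ i) (k : ℕ) :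
    t d u (i + 1) ^ k * e d u i = t d u i ^ k * e d u i :=
  right_pow_mul_avg (commute_t_t _ _ _ _) (t_pow_d _ _) (t_pow_d _ _) k

theorem t_pow_mul_e (i : ℕ) (hi : 1 ≤ i) (k : ℕ) :
    t d u i ^ k * e d u i =
      (1 / (d : ℂ)) • ∑ m ∈ Finset.range d, t d u i ^ (k + m) * t d u (i + 1) ^ (d - m) := by
  simp only [e, avg, mul_smul_comm, Finset.mul_sum, pow_add, mul_assoc]

end YInf

namespace IsJuyumayaTrace

open YInf

variable {d : ℕ} {u z : ℂ} {x : Fin (d - 1) → ℂ} {tr : YInf d u →ₗ[ℂ] ℂ}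

theorem tr_mul_g_mul (h : IsJuyumayaTrace d u z x tr) {n : ℕ} (hn : 1 ≤ n) {a b : YInf d u}
    (ha : a ∈ (Y.toInf d u n).range) (hb : b ∈ (Y.toInf d u n).range) :
    tr (a * g d u n * b) = z * tr (a * b) := by
  obtain ⟨a, rfl⟩ := ha
  obtain ⟨b, rfl⟩ := hb
  simpa using h.markov n hn a b

theorem tr_mul_t_pow_mul_g_mul (h : IsJuyumayaTrace d u z x tr) {n : ℕ} (hn : 1 ≤ n)
    {a b : YInf d u} (ha : a ∈ (Y.toInf d u n).range) (hb : b ∈ (Y.toInf d u n).range) (k : ℕ) :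
    tr (a * t d u (n + 1) ^ k * g d u n * b) = z * tr (a * t d u n ^ k * b) := by
  rw [mul_assoc a, ← ((semiconjBy_g_t n hn).pow_right k).eq, ← mul_assoc a, mul_assoc (a * _),
    h.tr_mul_g_mul hn ha (mul_mem (t_pow_mem hn le_rfl k) hb), ← mul_assoc]

variable [NeZero d]

theorem tr_mul_t_pow (h : IsJuyumayaTrace d u z x tr) {n : ℕ} {a : YInf d u}
    (ha : a ∈ (Y.toInf d u n).range) (k : ℕ) :
    tr (a * t d u (n + 1) ^ k) = xPar d x k * tr a := by
  obtain ⟨a, rfl⟩ := ha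
  rw [← t_pow_mod]
  have hlt := Nat.mod_lt k (NeZero.pos d)
  by_cases h0 : k % d = 0
  · simp [xPar, h0]
  · have hpos : 1 ≤ k % d := Nat.one_le_iff_ne_zero.2 h0
    have framing := h.framing n a ⟨k % d - 1, by omega⟩
    rw [xPar, dif_pos ⟨hpos, hlt⟩]
    simp only [Nat.sub_add_cancel hpos] at framing
    exact framing

theorem tr_t_pow (h : IsJuyumayaTrace d u z x tr) {i : ℕ} (hi : 1 ≤ i) (k : ℕ) :
    tr (t d u i ^ k) = xPar d x k := by
  obtain ⟨n, rfl⟩ := Nat.exists_eq_add_of_le' hi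
  simpa [h.trace_one] using h.tr_mul_t_pow (n := n) (one_mem _) k

section TwoStrands

variable (h : IsJuyumayaTrace d u z x tr) {i : ℕ} (hi : 1 ≤ i) (a b : ℕ)
include h

theorem tr_t_pow_mul_t_pow :
    tr (t d u i ^ a * t d u (i + 1) ^ b) = xPar d x a * xPar d x b := by
  rw [h.tr_mul_t_pow (t_pow_mem hi le_rfl a), h.tr_t_pow hi, mul_comm]

theorem tr_t_pow_mul_t_pow_mul_g :
    tr (t d u i ^ a * t d u (i + 1) ^ b * g d u i) = z * xPar d x (a + b) := by
  have markov := h.tr_mul_t_pow_mul_g_mul hi (t_pow_mem hi le_rfl a) (one_mem _) b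
  rwa [mul_one, mul_one, ← pow_add, h.tr_t_pow hi] at markov

theorem tr_t_pow_mul_e : tr (t d u i ^ a * e d u i) = shiftedEd d (xPar d x) a := by
  simp only [t_pow_mul_e, map_smul, map_sum, h.tr_t_pow_mul_t_pow hi, shiftedEd]

theorem tr_t_pow_mul_e_mul_g : tr (t d u i ^ a * e d u i * g d u i) = z * xPar d x a := by
  have term_eq : ∀ m ∈ Finset.range d,
      tr (t d u i ^ (a + m) * t d u (i + 1) ^ (d - m) * g d u i) = z * xPar d x a := by
    intro m hm
    have exponent : a + m + (d - m) = a + d := by have := Finset.mem_range.1 hm; omega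
    rw [h.tr_t_pow_mul_t_pow_mul_g hi, exponent, ← paramSeq_eq_xPar, paramSeq_periodic]
  rw [t_pow_mul_e, smul_mul_assoc, Finset.sum_mul, map_smul, map_sum, Finset.sum_congr rfl term_eq,
    Finset.sum_const, Finset.card_range, nsmul_eq_mul, smul_eq_mul, ← mul_assoc,
    one_div_mul_cancel (Nat.cast_ne_zero.2 (NeZero.ne d)), one_mul]

theorem tr_t_pow_mul_t_pow_mul_g_sq :
    tr (t d u i ^ a * t d u (i + 1) ^ b * g d u i ^ 2) =
      xPar d x a * xPar d x b + (u - 1) * shiftedEd d (xPar d x) (a + b) +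
        (u - 1) * (z * xPar d x (a + b)) := by
  have absorb : t d u i ^ a * t d u (i + 1) ^ b * e d u i = t d u i ^ (a + b) * e d u i := by
    rw [mul_assoc, t_succ_pow_mul_e, ← mul_assoc, ← pow_add]
  simp only [g_sq, mul_add, mul_one, mul_smul_comm, ← mul_assoc, absorb, map_add, map_smul,
    h.tr_t_pow_mul_t_pow hi, h.tr_t_pow_mul_e hi, h.tr_t_pow_mul_e_mul_g hi, smul_eq_mul]

end TwoStrands

theorem tr_mul_t_pow_mul_lin (h : IsJuyumayaTrace d u z x tr) {i : ℕ} (hi : 1 ≤ i)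
    {w : YInf d u} (hw : w ∈ (Y.toInf d u (i + 1)).range) (c : ℕ) :
    tr (w * t d u (i + 2) ^ c * lin (g d u i) (g d u (i + 1))) =
      z * tr (w * t d u i ^ c * g d u i ^ 2) + z * tr (w * t d u i ^ c * g d u i) +
        z * tr (w * t d u (i + 1) ^ c * g d u i) + xPar d x c * tr (w * g d u i) +
        z * tr (w * t d u (i + 1) ^ c) + xPar d x c * tr w := by
  have hg : g d u i ∈ (Y.toInf d u (i + 1)).range := g_mem hi (Nat.lt_succ_self i)
  have far : w * t d u (i + 2) ^ c * g d u i = w * g d u i * t d u (i + 2) ^ c := by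
    have comm : Commute (g d u i) (t d u (i + 2) ^ c) :=
      (commute_g_t i (i + 2) hi (by omega) (by omega) (by omega)).pow_right c
    rw [mul_assoc, ← comm.eq, mul_assoc]
  have near : w * g d u i * t d u (i + 1) ^ c = w * t d u i ^ c * g d u i := by
    rw [mul_assoc, ((semiconjBy_g_t_succ i hi).pow_right c).eq, mul_assoc]
  have markov {y : YInf d u} (hy : y ∈ (Y.toInf d u (i + 1)).range) :
      tr (w * t d u (i + 2) ^ c * g d u (i + 1) * y) = z * tr (w * t d u (i + 1) ^ c * y) :=
    h.tr_mul_t_pow_mul_g_mul (by omega) hw hy c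
  have markov_far {y : YInf d u} (hy : y ∈ (Y.toInf d u (i + 1)).range) :
      tr (w * t d u (i + 2) ^ c * g d u i * g d u (i + 1) * y) =
        z * tr (w * t d u i ^ c * g d u i * y) := by
    rw [far, h.tr_mul_t_pow_mul_g_mul (by omega) (mul_mem hw hg) hy c, near]
  have g_succ := markov (one_mem _)
  have g_g_succ := markov_far (one_mem _)
  have g_only := congrArg tr far
  rw [h.tr_mul_t_pow (mul_mem hw hg)] at g_only
  simp only [mul_one] at g_succ g_g_succ
  simp only [lin, mul_add, mul_one, map_add, ← mul_assoc]
  rw [markov_far hg, g_g_succ, markov hg, g_only, g_succ, h.tr_mul_t_pow hw,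
    mul_assoc _ _ (g d u i), ← sq]

theorem tr_framing_mul_lin (h : IsJuyumayaTrace d u z x tr) {i : ℕ} (hi : 1 ≤ i)
    (a b c : ℕ) :
    tr (t d u i ^ a * t d u (i + 1) ^ b * t d u (i + 2) ^ c * lin (g d u i) (g d u (i + 1))) =
      (u + 1) * xPar d x (a + b + c) * z ^ 2 +
        ((u - 1) * shiftedEd d (xPar d x) (a + b + c) + xPar d x (a + c) * xPar d x b +
          xPar d x (a + b) * xPar d x c + xPar d x a * xPar d x (b + c)) * z +
        xPar d x a * xPar d x b * xPar d x c := by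
  have merge_right : t d u i ^ a * t d u (i + 1) ^ b * t d u (i + 1) ^ c =
      t d u i ^ a * t d u (i + 1) ^ (b + c) := by
    rw [mul_assoc, ← pow_add]
  have merge_left : t d u i ^ a * t d u (i + 1) ^ b * t d u i ^ c =
      t d u i ^ (a + c) * t d u (i + 1) ^ b := by
    rw [mul_assoc, ← ((commute_t_t i (i + 1) hi (by omega)).pow_pow c b).eq, ← mul_assoc,
      ← pow_add]
  rw [h.tr_mul_t_pow_mul_lin hi
    (mul_mem (t_pow_mem hi (Nat.le_succ i) a) (t_pow_mem (by omega) le_rfl b)) c]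
  simp only [merge_left, merge_right, h.tr_t_pow_mul_t_pow_mul_g_sq hi,
    h.tr_t_pow_mul_t_pow_mul_g hi, h.tr_t_pow_mul_t_pow hi, add_right_comm a c b,
    ← add_assoc]
  ring

theorem tr_e (h : IsJuyumayaTrace d u z x tr) {i : ℕ} (hi : 1 ≤ i) :
    tr (e d u i) = Ed d x := by
  simpa [shiftedEd_zero] using h.tr_t_pow_mul_e hi 0

theorem tr_lin (h : IsJuyumayaTrace d u z x tr) {i : ℕ} (hi : 1 ≤ i) :
    tr (lin (g d u i) (g d u (i + 1))) = (u + 1) * z ^ 2 + ((u - 1) * Ed d x + 3) * z + 1 := by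
  have xPar_zero : xPar d x 0 = 1 := paramSeq_zero x
  have trace := h.tr_framing_mul_lin hi 0 0 0
  simp only [pow_zero, one_mul, add_zero, xPar_zero, shiftedEd_zero] at trace
  rw [trace]
  ring

end IsJuyumayaTrace

theorem quadratic_eq_zero_iff_eq_z₁_or_eq_z₂ {u : ℂ} (hu : u ≠ -1) (z E : ℂ) :
    (u + 1) * z ^ 2 + ((u - 1) * E + 3) * z + 1 = 0 ↔ z = z₁ u E ∨ z = z₂ u E := by
  have leading_ne_zero : u + 1 ≠ 0 := fun h => hu (eq_neg_of_add_eq_zero_left h)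
  have discrim_eq_sq : discrim (u + 1) ((u - 1) * E + 3) 1 =
      Complex.sqrt ((u * E - E + 3) ^ 2 - 4 * (u + 1)) *
        Complex.sqrt ((u * E - E + 3) ^ 2 - 4 * (u + 1)) := by
    have sqrt_sq (w : ℂ) : Complex.sqrt w ^ 2 = w := by simp [Complex.sqrt]
    rw [← sq, sqrt_sq, discrim]
    ring
  rw [sq, quadratic_eq_zero_iff leading_ne_zero discrim_eq_sq, z₁, z₂]
  ring_nf

theorem FactorsThroughYTL.tr_mul_lin {d : ℕ} {u : ℂ} {i n : ℕ} {tr : YInf d u →ₗ[ℂ] ℂ}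
    (h : FactorsThroughYTL d u n tr) (hi : 1 ≤ i) (hin : i + 1 < n) {a : YInf d u}
    (ha : a ∈ (Y.toInf d u n).range) :
    tr (a * lin (YInf.g d u i) (YInf.g d u (i + 1))) = 0 := by
  obtain ⟨τ, hτ⟩ := h
  obtain ⟨a, rfl⟩ := ha
  have mk_lin : YTL.mk d u n (lin (Y.g d u n i) (Y.g d u n (i + 1))) = 0 :=
    (RingQuot.mkAlgHom_rel ℂ (YTLRel.linear (d := d) (u := u) (n := n) i
      ⟨hi, by omega⟩ ⟨by omega, hin⟩)).trans (map_zero _)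
  have value := hτ (a * lin (Y.g d u n i) (Y.g d u n (i + 1)))
  rw [map_mul, mk_lin, mul_zero, map_zero, map_mul, map_lin, YInf.toInf_g, YInf.toInf_g] at value
  exact value.symm

theorem FactorsThroughYTLInf.factorsThroughYTL {d : ℕ} {u : ℂ} {tr : YInf d u →ₗ[ℂ] ℂ}
    (h : FactorsThroughYTLInf d u tr) (n : ℕ) : FactorsThroughYTL d u n tr := by
  obtain ⟨τ, hτ⟩ := h
  refine ⟨τ.comp (YTL.toInf d u n).toLinearMap, fun a => ?_⟩
  rw [← hτ, YTLInf.mk_toInf]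
  rfl

section Eliminant

variable {R S : Type*} [CommRing R] [CommRing S]

/-- The resultant in `z` of `v z² + e z + 1` and `B z + c`. -/
def eliminant (v e B c : R) : R :=
  v * c ^ 2 - e * B * c + B ^ 2

theorem eliminant_eq_zero {v e B c z : R} (hquad : v * z ^ 2 + e * z + 1 = 0)
    (hlin : B * z + c = 0) : eliminant v e B c = 0 := by
  obtain rfl : c = -(B * z) := by linear_combination hlin
  rw [eliminant]
  linear_combination B ^ 2 * hquad

theorem map_eliminant (φ : R →+* S) (v e B c : R) :
    φ (eliminant v e B c) = eliminant (φ v) (φ e) (φ B) (φ c) := by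
  simp only [eliminant, map_add, map_sub, map_mul, map_pow]

open Polynomial in
theorem eliminant_ne_zero [IsDomain R] (v : R) {e B c : R[X]} (hB : B ≠ 0)
    (hdeg : c ≠ 0 → B.natDegree < e.natDegree + c.natDegree ∧
      c.natDegree < e.natDegree + B.natDegree) : eliminant (C v) e B c ≠ 0 := by
  rcases eq_or_ne c 0 with rfl | hc
  · simpa [eliminant] using hB
  obtain ⟨hBc, hcB⟩ := hdeg hc
  rcases eq_or_ne e 0 with rfl | he
  · simp only [natDegree_zero] at hBc hcB
    omega
  have dominant : (e * B * c).natDegree = e.natDegree + B.natDegree + c.natDegree := by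
    rw [natDegree_mul (mul_ne_zero he hB) hc, natDegree_mul he hB]
  have rest_le : (C v * c ^ 2 + B ^ 2).natDegree < (e * B * c).natDegree := by
    refine (natDegree_add_le _ _).trans_lt (max_lt ?_ ?_)
    · refine (natDegree_C_mul_le v (c ^ 2)).trans_lt ?_
      rw [natDegree_pow, dominant]
      omega
    · rw [natDegree_pow, dominant]
      omega
  intro h
  have equal : e * B * c = C v * c ^ 2 + B ^ 2 := by
    rw [eliminant] at h
    linear_combination -h
  rw [equal] at rest_le
  exact lt_irrefl _ rest_le

end Eliminant

section Obstruction

variable {R S : Type*} [CommRing R] [Algebra ℂ R] [CommRing S] [Algebra ℂ S]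

/-- The coefficient of `z` in `tr (t_i^a t_{i+1}^b t_{i+2}^c L_i) - x_{a+b+c} tr (L_i)`, with a
sequence `f` of period `d` in place of `x`. -/
noncomputable def linearCoeff (d : ℕ) (u : ℂ) (f : ℕ → R) (a b c : ℕ) : R :=
  algebraMap ℂ R (u - 1) * (shiftedEd d f (a + b + c) - f (a + b + c) * shiftedEd d f 0) +
    (f (a + c) * f b + f (a + b) * f c + f a * f (b + c) - 3 * f (a + b + c))

/-- The constant coefficient of the same polynomial in `z` as in `linearCoeff`. -/
def constCoeff (f : ℕ → R) (a b c : ℕ) : R :=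
  f a * f b * f c - f (a + b + c)

/-- The coefficient of `z` in `tr (L_i)`. -/
noncomputable def middleCoeff (d : ℕ) (u : ℂ) (f : ℕ → R) : R :=
  algebraMap ℂ R (u - 1) * shiftedEd d f 0 + 3

/-- The resultant in `z` of `tr (L_i)` and
`tr (t_i^a t_{i+1}^b t_{i+2}^c L_i) - x_{a+b+c} tr (L_i)`. If it is nonzero, then `tr (L_i)` and
`tr (t_i^a t_{i+1}^b t_{i+2}^c L_i)` are not both zero. -/
noncomputable def obstruction (d : ℕ) (u : ℂ) (f : ℕ → R) (a b c : ℕ) : R :=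
  eliminant (algebraMap ℂ R (u + 1)) (middleCoeff d u f) (linearCoeff d u f a b c)
    (constCoeff f a b c)

theorem map_obstruction (φ : R →ₐ[ℂ] S) (d : ℕ) (u : ℂ) (f : ℕ → R) (a b c : ℕ) :
    φ (obstruction d u f a b c) = obstruction d u (fun k => φ (f k)) a b c := by
  have map_resultant := map_eliminant (φ : R →+* S)
  simp only [RingHom.coe_coe] at map_resultant
  simp only [obstruction, map_resultant, middleCoeff, linearCoeff, constCoeff, map_add, map_sub,
    map_mul, map_shiftedEd, map_ofNat, AlgHom.commutes]

end Obstruction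

section ConstantParameters

open Polynomial

/-- The parameters `x₁ = ⋯ = x_{d-1} = X`. -/
noncomputable def constParam (d : ℕ) : ℕ → ℂ[X] :=
  paramSeq d fun _ => X

variable {d : ℕ} [NeZero d]

theorem constParam_of_dvd {k : ℕ} (hk : d ∣ k) : constParam d k = 1 := by
  rw [constParam, paramSeq_const, if_pos hk]

theorem constParam_of_not_dvd {k : ℕ} (hk : ¬ d ∣ k) : constParam d k = X := by
  rw [constParam, paramSeq_const, if_neg hk]

theorem natDegree_constParam_le (k : ℕ) : (constParam d k).natDegree ≤ 1 := by
  rw [constParam, paramSeq_const]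
  split_ifs <;> simp

theorem natDegree_constParam_mul_le (j k : ℕ) :
    (constParam d j * constParam d k).natDegree ≤ 2 :=
  natDegree_mul_le_of_le (natDegree_constParam_le j) (natDegree_constParam_le k)

theorem natDegree_shiftedEd_constParam_le (k : ℕ) :
    (shiftedEd d (constParam d) k).natDegree ≤ 2 :=
  (natDegree_smul_le _ _).trans <|
    natDegree_sum_le_of_forall_le _ _ fun _ _ => natDegree_constParam_mul_le _ _

theorem shiftedEd_zero_constParam :
    shiftedEd d (constParam d) 0 = C (((d - 1 : ℕ) : ℂ) / d) * X ^ 2 + C (1 / (d : ℂ)) := by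
  obtain ⟨n, rfl⟩ := Nat.exists_eq_add_one_of_ne_zero (NeZero.ne d)
  have off_origin : ∀ m ∈ Finset.range n,
      constParam (n + 1) (0 + (m + 1)) * constParam (n + 1) (n + 1 - (m + 1)) = X ^ 2 := by
    intro m hm
    have hmn := Finset.mem_range.1 hm
    rw [constParam_of_not_dvd (Nat.not_dvd_of_pos_of_lt (by omega) (by omega)),
      constParam_of_not_dvd (Nat.not_dvd_of_pos_of_lt (by omega) (by omega)), sq]
  have at_origin : constParam (n + 1) (0 + 0) * constParam (n + 1) (n + 1 - 0) = 1 := by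
    simp [constParam_of_dvd]
  rw [shiftedEd, Finset.sum_range_succ', Finset.sum_congr rfl off_origin, at_origin,
    Finset.sum_const, Finset.card_range, smul_eq_C_mul, nsmul_eq_mul, mul_add, ← mul_assoc,
    ← C_eq_natCast, ← C_mul, Nat.add_sub_cancel, one_div_mul_eq_div, mul_one]

theorem natDegree_mul_shiftedEd_zero_constParam (hd : d ≠ 1) {r : ℂ} (hr : r ≠ 0) :
    (C r * shiftedEd d (constParam d) 0).natDegree = 2 := by
  have leading_ne_zero : ((d - 1 : ℕ) : ℂ) / d ≠ 0 :=
    div_ne_zero (Nat.cast_ne_zero.2 (by have := NeZero.ne d; omega))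
      (Nat.cast_ne_zero.2 (NeZero.ne d))
  rw [natDegree_C_mul hr, shiftedEd_zero_constParam, natDegree_add_C,
    natDegree_C_mul_X_pow _ _ leading_ne_zero]

theorem natDegree_middleCoeff_constParam (hd : d ≠ 1) {u : ℂ} (hu : u ≠ 1) :
    (middleCoeff d u (constParam d)).natDegree = 2 := by
  rw [middleCoeff, ← C_ofNat, natDegree_add_C]
  exact natDegree_mul_shiftedEd_zero_constParam hd (sub_ne_zero.2 hu)

theorem constParam_eq_X_pow (k : ℕ) :
    constParam d k = X ^ (if d ∣ k then 0 else 1) := by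
  rw [constParam, paramSeq_const]
  split_ifs <;> simp

theorem exists_constParam_mul_mul_eq_X_pow {a b c : ℕ}
    (habc : ¬ (d ∣ a ∧ d ∣ b ∧ d ∣ c)) :
    ∃ n, 1 ≤ n ∧ n ≤ 3 ∧ constParam d a * constParam d b * constParam d c = X ^ n := by
  simp only [constParam_eq_X_pow, ← pow_add]
  refine ⟨_, ?_, ?_, rfl⟩ <;> split_ifs <;> omega

theorem natDegree_constCoeff_constParam_of_dvd {a b c : ℕ}
    (habc : ¬ (d ∣ a ∧ d ∣ b ∧ d ∣ c)) (hs : d ∣ a + b + c) :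
    1 ≤ (constCoeff (constParam d) a b c).natDegree ∧
      (constCoeff (constParam d) a b c).natDegree ≤ 3 := by
  obtain ⟨n, hn, hn', monomial⟩ := exists_constParam_mul_mul_eq_X_pow habc
  rw [constCoeff, monomial, constParam_of_dvd hs, ← C_1, natDegree_X_pow_sub_C]
  exact ⟨hn, hn'⟩

theorem natDegree_constCoeff_constParam_of_not_dvd {a b c : ℕ}
    (hs : ¬ d ∣ a + b + c) (hne : constCoeff (constParam d) a b c ≠ 0) :
    2 ≤ (constCoeff (constParam d) a b c).natDegree ∧
      (constCoeff (constParam d) a b c).natDegree ≤ 3 := by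
  have habc : ¬ (d ∣ a ∧ d ∣ b ∧ d ∣ c) := fun ⟨ha, hb, hc⟩ =>
    hs (dvd_add (dvd_add ha hb) hc)
  obtain ⟨n, hn, hn', monomial⟩ := exists_constParam_mul_mul_eq_X_pow habc
  rw [constCoeff, monomial, constParam_of_not_dvd hs] at hne ⊢
  have two_le : 2 ≤ n := by
    by_contra!
    obtain rfl : n = 1 := by omega
    simp at hne
  rw [natDegree_sub_eq_left_of_natDegree_lt (by simpa using Nat.lt_of_succ_le two_le),
    natDegree_X_pow]
  exact ⟨two_le, hn'⟩

theorem natDegree_linearCoeff_constParam_of_dvd (u : ℂ) {a b c : ℕ}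
    (habc : ¬ (d ∣ a ∧ d ∣ b ∧ d ∣ c)) (hs : d ∣ a + b + c) :
    (linearCoeff d u (constParam d) a b c).natDegree = 2 := by
  let ν (k : ℕ) : ℂ := if d ∣ k then 0 else 1
  have mul_eq {j k : ℕ} (hjk : d ∣ j + k) :
      constParam d j * constParam d k = C (ν k) * (X ^ 2 - C 1) + 1 := by
    by_cases hk : d ∣ k
    · simp [ν, constParam_of_dvd, hk, (Nat.dvd_add_left hk).1 hjk]
    · have hj : ¬ d ∣ j := fun hj => hk ((Nat.dvd_add_right hj).1 hjk)
      simp [ν, constParam_of_not_dvd, hk, hj, sq]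
  have value : linearCoeff d u (constParam d) a b c =
      C (ν b + ν c + ν a) * (X ^ 2 - C 1) := by
    rw [linearCoeff, shiftedEd_of_dvd (f := constParam d) (paramSeq_periodic _) hs,
      constParam_of_dvd hs, mul_eq (by rwa [add_right_comm] at hs), mul_eq hs,
      mul_comm (constParam d a), mul_eq (by rwa [add_rotate] at hs), C_add, C_add]
    ring
  have count_ne_zero : ν b + ν c + ν a ≠ 0 := by
    simp only [ν]
    split_ifs <;> first | tauto | norm_num
  rw [value, natDegree_C_mul count_ne_zero, natDegree_X_pow_sub_C]

theorem natDegree_linearCoeff_constParam_of_not_dvd (hd : d ≠ 1) {u : ℂ} (hu : u ≠ 1)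
    {a b c : ℕ} (hs : ¬ d ∣ a + b + c) :
    (linearCoeff d u (constParam d) a b c).natDegree = 3 := by
  let cubic : ℂ[X] := C (u - 1) * shiftedEd d (constParam d) 0 * X
  let rest : ℂ[X] := C (u - 1) * shiftedEd d (constParam d) (a + b + c) +
    (constParam d (a + c) * constParam d b + constParam d (a + b) * constParam d c +
      constParam d a * constParam d (b + c) - 3 * X)
  have split : linearCoeff d u (constParam d) a b c = rest - cubic := by
    rw [linearCoeff, constParam_of_not_dvd hs, ← C_eq_algebraMap]
    ring
  have cubic_degree : cubic.natDegree = 3 := by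
    have quadratic_degree := natDegree_mul_shiftedEd_zero_constParam hd (sub_ne_zero.2 hu)
    rw [natDegree_mul_X (ne_zero_of_natDegree_gt (n := 1) (by omega)), quadratic_degree]
  have rest_degree : rest.natDegree ≤ 2 := by
    have three_mul_X : (3 * X : ℂ[X]).natDegree ≤ 2 := by
      rw [← C_ofNat, natDegree_C_mul_X _ (by norm_num)]
      norm_num
    exact natDegree_add_le_of_degree_le
      ((natDegree_C_mul_le _ _).trans (natDegree_shiftedEd_constParam_le _))
      ((natDegree_sub_le_of_le (natDegree_add_le_of_degree_le (natDegree_add_le_of_degree_le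
        (natDegree_constParam_mul_le _ _) (natDegree_constParam_mul_le _ _))
        (natDegree_constParam_mul_le _ _)) three_mul_X).trans_eq (max_self 2))
  rw [split, natDegree_sub_eq_right_of_natDegree_lt (by omega), cubic_degree]

theorem obstruction_constParam_ne_zero (hd : d ≠ 1) {u : ℂ} (hu : u ≠ 1) {a b c : ℕ}
    (habc : ¬ (d ∣ a ∧ d ∣ b ∧ d ∣ c)) : obstruction d u (constParam d) a b c ≠ 0 := by
  have middle := natDegree_middleCoeff_constParam hd hu
  by_cases hs : d ∣ a + b + c
  · have linear := natDegree_linearCoeff_constParam_of_dvd u habc hs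
    have const := natDegree_constCoeff_constParam_of_dvd habc hs
    exact eliminant_ne_zero _ (ne_zero_of_natDegree_gt (n := 1) (by omega))
      fun _ => by omega
  · have linear := natDegree_linearCoeff_constParam_of_not_dvd hd hu hs
    refine eliminant_ne_zero _ (ne_zero_of_natDegree_gt (n := 1) (by omega)) fun hne => ?_
    have const := natDegree_constCoeff_constParam_of_not_dvd hs hne
    omega

end ConstantParameters

/-- The product of the obstructions over the triples of exponents below `d` that are not all zero.
If it does not vanish at `x`, then the trace with parameters `x` does not factor. -/
noncomputable def genericPoly (d : ℕ) (u : ℂ) : MvPolynomial (Fin (d - 1)) ℂ :=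
  ∏ p : Fin d × Fin d × Fin d with ¬ (d ∣ p.1 ∧ d ∣ p.2.1 ∧ d ∣ p.2.2),
    obstruction d u (paramSeq d MvPolynomial.X) p.1 p.2.1 p.2.2

theorem aeval_obstruction {R : Type*} [CommRing R] [Algebra ℂ R] (d : ℕ) (u : ℂ)
    (y : Fin (d - 1) → R) (a b c : ℕ) :
    MvPolynomial.aeval y (obstruction d u (paramSeq d (MvPolynomial.X (R := ℂ))) a b c) =
      obstruction d u (paramSeq d y) a b c := by
  let φ : MvPolynomial (Fin (d - 1)) ℂ →ₐ[ℂ] R := MvPolynomial.aeval y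
  have map_X (k : ℕ) : φ (paramSeq d MvPolynomial.X k) = paramSeq d y k := by
    simpa [φ] using map_paramSeq (φ : MvPolynomial (Fin (d - 1)) ℂ →+* R) MvPolynomial.X k
  refine (map_obstruction φ d u _ a b c).trans ?_
  simp only [map_X]

theorem genericPoly_ne_zero {d : ℕ} [NeZero d] (hd : d ≠ 1) {u : ℂ} (hu : u ≠ 1) :
    genericPoly d u ≠ 0 := by
  refine Finset.prod_ne_zero_iff.2 fun p hp h0 => ?_
  have specialized := congrArg (MvPolynomial.aeval fun _ => (Polynomial.X : Polynomial ℂ)) h0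
  rw [aeval_obstruction, map_zero] at specialized
  exact obstruction_constParam_ne_zero hd hu (Finset.mem_filter.1 hp).2 specialized

theorem obstruction_xPar_ne_zero {d : ℕ} {u : ℂ} {x : Fin (d - 1) → ℂ}
    (hx : MvPolynomial.eval x (genericPoly d u) ≠ 0) (a b c : Fin d)
    (habc : ¬ (d ∣ a ∧ d ∣ b ∧ d ∣ c)) : obstruction d u (xPar d x) a b c ≠ 0 := by
  rw [genericPoly, map_prod, Finset.prod_ne_zero_iff] at hx
  have factor := hx (a, b, c) (by simpa using habc)
  rw [← MvPolynomial.coe_aeval_eq_eval] at factor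
  simpa only [RingHom.coe_coe, aeval_obstruction, paramSeq_eq_xPar] using factor

theorem mul_lin {A : Type} [Ring A] (w a b : A) :
    w * lin a b = w * (a * b * a) - w * (-(a * b) - b * a - a - b - 1) := by
  rw [lin, ← mul_sub]
  congr 1
  abel

namespace IsJuyumayaTrace

open YInf

variable {d : ℕ} [NeZero d] {u z : ℂ} {x : Fin (d - 1) → ℂ} {tr : YInf d u →ₗ[ℂ] ℂ}

theorem obstruction_eq_zero (h : IsJuyumayaTrace d u z x tr) {i : ℕ} (hi : 1 ≤ i)
    {a b c : ℕ} (hz : (u + 1) * z ^ 2 + ((u - 1) * Ed d x + 3) * z + 1 = 0)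
    (hw : tr (t d u i ^ a * t d u (i + 1) ^ b * t d u (i + 2) ^ c *
      lin (g d u i) (g d u (i + 1))) = 0) : obstruction d u (xPar d x) a b c = 0 := by
  rw [h.tr_framing_mul_lin hi] at hw
  refine eliminant_eq_zero (z := z) ?_ ?_
  · simpa [middleCoeff, shiftedEd_zero] using hz
  · rw [linearCoeff, constCoeff, shiftedEd_zero, Algebra.algebraMap_self, RingHom.id_apply]
    linear_combination hw - xPar d x (a + b + c) * hz

theorem tr_framing_mul_lin_ne_zero (h : IsJuyumayaTrace d u z x tr)
    (hx : MvPolynomial.eval x (genericPoly d u) ≠ 0)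
    (hz : (u + 1) * z ^ 2 + ((u - 1) * Ed d x + 3) * z + 1 = 0) {i : ℕ} (hi : 1 ≤ i) {a b c : ℕ}
    (habc : ¬ (d ∣ a ∧ d ∣ b ∧ d ∣ c)) :
    tr (t d u i ^ a * t d u (i + 1) ^ b * t d u (i + 2) ^ c * lin (g d u i) (g d u (i + 1))) ≠
      0 := by
  rw [← t_pow_mod i hi a, ← t_pow_mod (i + 1) (by omega) b, ← t_pow_mod (i + 2) (by omega) c]
  intro hw
  have mod_lt (k : ℕ) : k % d < d := Nat.mod_lt k (NeZero.pos d)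
  exact obstruction_xPar_ne_zero hx ⟨a % d, mod_lt a⟩ ⟨b % d, mod_lt b⟩
    ⟨c % d, mod_lt c⟩ (by simpa [Nat.dvd_mod_iff] using habc)
    (h.obstruction_eq_zero hi hz hw)

theorem quadratic_of_factorsThroughYTL (h : IsJuyumayaTrace d u z x tr) {n : ℕ}
    (hn : 3 ≤ n) (hf : FactorsThroughYTL d u n tr) :
    (u + 1) * z ^ 2 + ((u - 1) * Ed d x + 3) * z + 1 = 0 := by
  have tr_lin_eq_zero := hf.tr_mul_lin (i := 1) le_rfl (by omega) (one_mem _)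
  rwa [one_mul, h.tr_lin le_rfl] at tr_lin_eq_zero

theorem not_factorsThroughYTL (h : IsJuyumayaTrace d u z x tr) (hd : d ≠ 1)
    (hx : MvPolynomial.eval x (genericPoly d u) ≠ 0) {n : ℕ} (hn : 3 ≤ n) :
    ¬ FactorsThroughYTL d u n tr := by
  intro hf
  have not_all_dvd : ¬ (d ∣ 1 ∧ d ∣ 0 ∧ d ∣ 0) := fun ⟨dvd_one, _⟩ =>
    hd (Nat.dvd_one.1 dvd_one)
  refine h.tr_framing_mul_lin_ne_zero hx (h.quadratic_of_factorsThroughYTL hn hf)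
    le_rfl not_all_dvd ?_
  exact hf.tr_mul_lin le_rfl (by omega) (mul_mem (mul_mem (t_pow_mem le_rfl (by omega) 1)
    (t_pow_mem (by omega) (by omega) 0)) (t_pow_mem (by omega) hn 0))

end IsJuyumayaTrace

end Yokonuma

open Yokonuma in
theorem mainTheorem2 (d : ℕ) (hd : 1 ≤ d) (u : ℂ) (hu0 : u ≠ 0) (hu1 : u ≠ 1) :
    (∀ (z : ℂ) (x : Fin (d - 1) → ℂ) (tr : YInf d u →ₗ[ℂ] ℂ), IsJuyumayaTrace d u z x tr →
      (∀ (i : ℕ) (hi : 1 ≤ i), tr (YInf.e d u i) = Ed d x) ∧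
      (∀ (i : ℕ) (hi : 1 ≤ i), tr (lin (YInf.g d u i) (YInf.g d u (i + 1))) = 0 ↔
        (u + 1) * z ^ 2 + ((u - 1) * Ed d x + 3) * z + 1 = 0) ∧
      (u ≠ -1 → ((u + 1) * z ^ 2 + ((u - 1) * Ed d x + 3) * z + 1 = 0 ↔
        z = z₁ u (Ed d x) ∨ z = z₂ u (Ed d x))) ∧
      (FactorsThroughYTLInf d u tr →
        (u + 1) * z ^ 2 + ((u - 1) * Ed d x + 3) * z + 1 = 0)) ∧
    (2 ≤ d → ∃ P : MvPolynomial (Fin (d - 1)) ℂ, P ≠ 0 ∧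
      ∀ (z : ℂ) (x : Fin (d - 1) → ℂ) (tr : YInf d u →ₗ[ℂ] ℂ), IsJuyumayaTrace d u z x tr →
        MvPolynomial.eval x P ≠ 0 →
        ¬ FactorsThroughYTLInf d u tr ∧
        (∀ n : ℕ, 3 ≤ n → ¬ FactorsThroughYTL d u n tr) ∧
        ((u + 1) * z ^ 2 + ((u - 1) * Ed d x + 3) * z + 1 = 0 →
          ∀ k₁ k₂ k : ℕ, ¬ (d ∣ k₁ ∧ d ∣ k₂ ∧ d ∣ k) →
            ∀ w : Y d u 3, w = Y.t d u 3 1 ^ k₁ * Y.t d u 3 2 ^ k₂ * Y.t d u 3 3 ^ k →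
              tr (Y.toInf d u 3 (w * (Y.g d u 3 1 * Y.g d u 3 2 * Y.g d u 3 1))) ≠
                tr (Y.toInf d u 3 (w * (- (Y.g d u 3 1 * Y.g d u 3 2)
                  - Y.g d u 3 2 * Y.g d u 3 1 - Y.g d u 3 1 - Y.g d u 3 2 - 1))))) := by
  have : NeZero d := ⟨Nat.one_le_iff_ne_zero.1 hd⟩
  refine ⟨fun z x tr h => ⟨fun i hi => h.tr_e hi, fun i hi => by rw [h.tr_lin hi],
    fun hu => quadratic_eq_zero_iff_eq_z₁_or_eq_z₂ hu z _,
    fun hf => h.quadratic_of_factorsThroughYTL le_rfl (hf.factorsThroughYTL 3)⟩, fun hd₂ =>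
    ⟨genericPoly d u, genericPoly_ne_zero (Nat.ne_of_gt hd₂) hu1, fun z x tr h hx =>
      ⟨fun hf => h.not_factorsThroughYTL (Nat.ne_of_gt hd₂) hx le_rfl (hf.factorsThroughYTL 3),
        fun n hn => h.not_factorsThroughYTL (Nat.ne_of_gt hd₂) hx hn, ?_⟩⟩⟩
  rintro hz k₁ k₂ k hk w rfl heq
  refine h.tr_framing_mul_lin_ne_zero hx hz le_rfl hk ?_
  simp only [map_mul, map_pow, map_sub, map_neg, map_one, YInf.toInf_t, YInf.toInf_g] at heq
  rw [mul_lin, map_sub, heq, sub_self]
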